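/- Let $(M,g)$ be a smooth Riemannian manifold (without boundary) with Levi-Civita connection $D$, let $\Psi : M \to \mathbb{R}$ be smooth, and let $$\Delta_\Psi u = \Delta u - g(\nabla \Psi, \nabla u), \qquad \Delta u = \operatorname{div}(\nabla u) = \operatorname{trace}\operatorname{Hess}(u),$$ be the weighted Laplacian of the weighted manifold $M_\Psi = (M, g, e^{-\Psi}\mathrm{dv})$. Let $\Omega \subseteq M$ be open, and let $X$ be a smooth vector field that is Killing on $\Omega$, i.e. $g(D_Y X, Z) + g(D_Z X, Y) = 0$ on $\Omega$ for all vector fields $Y, Z$. If $g(X, \nabla \Psi)$ is constant on $\Omega$, then $[\Delta_\Psi, X] = 0$ on $\Omega$, in the sense that for every smooth function $u : \Omega \to \mathbb{R}$, $$\Delta_\Psi\big(X(u)\big) = X\big(\Delta_\Psi u\big) \quad \text{on } \Omega .$$ -/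

import Mathlib

open scoped Manifold ContDiff Bundle Topology
open Bundle VectorField

set_option linter.unusedSectionVars false

noncomputable section

namespace WeightedManifold

variable {E : Type*} [NormedAddCommGroup E] [NormedSpace ℝ E]
  {H : Type*} [TopologicalSpace H] (I : ModelWithCorners ℝ E H)
  {M : Type*} [TopologicalSpace M] [ChartedSpace H M]
  [RiemannianBundle (fun x : M ↦ TangentSpace I x)]

/-- The function `g(X, Y)` of two vector fields. -/
def metric (X Y : Π x : M, TangentSpace I x) (x : M) : ℝ := inner ℝ (X x) (Y x)

/-- The right-hand side of the Koszul formula, so that `koszul X Y Z = g(∇_X Y, Z)` for the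
Levi-Civita connection `∇`. -/
def koszul (X Y Z : Π x : M, TangentSpace I x) (x : M) : ℝ :=
  (1 / 2) * (mvfderiv I (metric I Y Z) x (X x) + mvfderiv I (metric I Z X) x (Y x)
    - mvfderiv I (metric I X Y) x (Z x)
    + metric I (mlieBracket I X Y) Z x - metric I (mlieBracket I Y Z) X x
    + metric I (mlieBracket I Z X) Y x)


variable {I}

lemma metric_apply (X Y : Π x : M, TangentSpace I x) (x : M) :
    metric I X Y x = inner ℝ (X x) (Y x) := rfl

lemma metric_smul_left (f : M → ℝ) (X Y : Π x : M, TangentSpace I x) :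
    metric I (f • X) Y = f * metric I X Y := by
  ext x; simp [metric, inner_smul_left]

lemma metric_add_left (X X' Y : Π x : M, TangentSpace I x) :
    metric I (X + X') Y = metric I X Y + metric I X' Y := by
  ext x; simp [metric, inner_add_left]

lemma metric_comm (X Y : Π x : M, TangentSpace I x) : metric I X Y = metric I Y X := by
  ext x; simp [metric, real_inner_comm]

lemma metric_smul_right (f : M → ℝ) (X Y : Π x : M, TangentSpace I x) :
    metric I Y (f • X) = f * metric I Y X := by
  rw [metric_comm, metric_smul_left, metric_comm]

lemma metric_add_right (X X' Y : Π x : M, TangentSpace I x) :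
    metric I Y (X + X') = metric I Y X + metric I Y X' := by
  ext x; simp [metric, inner_add_right]

variable [FiniteDimensional ℝ E] [IsManifold I ∞ M]
  [IsContMDiffRiemannianBundle I ∞ E (fun x : M ↦ TangentSpace I x)]

lemma mdiffAt_metric {X Y : Π x : M, TangentSpace I x} {x : M}
    (hX : MDiffAt (T% X) x) (hY : MDiffAt (T% Y) x) : MDiffAt (metric I X Y) x :=
  MDifferentiableAt.inner_bundle (E := fun x : M ↦ TangentSpace I x) hX hY

lemma koszul_add_left {X X' Y Z : Π x : M, TangentSpace I x} {x : M}
    (hX : MDiffAt (T% X) x) (hX' : MDiffAt (T% X') x) (hY : MDiffAt (T% Y) x)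
    (hZ : MDiffAt (T% Z) x) :
    koszul I (X + X') Y Z x = koszul I X Y Z x + koszul I X' Y Z x := by
  simp only [koszul, metric_add_left, metric_add_right,
    mvfderiv_add (mdiffAt_metric hX hY) (mdiffAt_metric hX' hY),
    mvfderiv_add (mdiffAt_metric hZ hX) (mdiffAt_metric hZ hX')]
  simp only [metric_apply, mlieBracket_add_left hX hX', mlieBracket_add_right hX hX',
    Pi.add_apply, inner_add_left, map_add, add_apply]
  ring

lemma koszul_smul_left {X Y Z : Π x : M, TangentSpace I x} {f : M → ℝ} {x : M}
    (hf : MDiffAt f x) (hX : MDiffAt (T% X) x) (hY : MDiffAt (T% Y) x) (hZ : MDiffAt (T% Z) x) :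
    koszul I (f • X) Y Z x = f x * koszul I X Y Z x := by
  simp only [koszul, metric_smul_left, metric_smul_right,
    mvfderiv_mul hf (mdiffAt_metric hX hY), mvfderiv_mul hf (mdiffAt_metric hZ hX)]
  simp only [metric_apply, mlieBracket_smul_left hf hX, mlieBracket_smul_right hf hX,
    Pi.smul_apply', Pi.mul_apply, inner_add_left, real_inner_smul_left, map_smul, smul_eq_mul,
    add_apply, smul_apply, neg_smul, inner_neg_left]
  rw [real_inner_comm (X x) (Z x)]
  ring

lemma koszul_add_right {X Y Z Z' : Π x : M, TangentSpace I x} {x : M}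
    (hX : MDiffAt (T% X) x) (hY : MDiffAt (T% Y) x)
    (hZ : MDiffAt (T% Z) x) (hZ' : MDiffAt (T% Z') x) :
    koszul I X Y (Z + Z') x = koszul I X Y Z x + koszul I X Y Z' x := by
  simp only [koszul, metric_add_left, metric_add_right,
    mvfderiv_add (mdiffAt_metric hY hZ) (mdiffAt_metric hY hZ'),
    mvfderiv_add (mdiffAt_metric hZ hX) (mdiffAt_metric hZ' hX)]
  simp only [metric_apply, mlieBracket_add_left hZ hZ', mlieBracket_add_right hZ hZ',
    Pi.add_apply, inner_add_left, map_add, add_apply]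
  ring

lemma koszul_smul_right {X Y Z : Π x : M, TangentSpace I x} {f : M → ℝ} {x : M}
    (hf : MDiffAt f x) (hX : MDiffAt (T% X) x) (hY : MDiffAt (T% Y) x) (hZ : MDiffAt (T% Z) x) :
    koszul I X Y (f • Z) x = f x * koszul I X Y Z x := by
  simp only [koszul, metric_smul_left, metric_smul_right,
    mvfderiv_mul hf (mdiffAt_metric hY hZ), mvfderiv_mul hf (mdiffAt_metric hZ hX)]
  simp only [metric_apply, mlieBracket_smul_left hf hZ, mlieBracket_smul_right hf hZ,
    Pi.smul_apply', Pi.mul_apply, inner_add_left, real_inner_smul_left, map_smul, smul_eq_mul,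
    add_apply, smul_apply, neg_smul, inner_neg_left]
  rw [real_inner_comm (Z x) (Y x)]
  ring

lemma koszul_add_mid {X Y Y' Z : Π x : M, TangentSpace I x} {x : M}
    (hX : MDiffAt (T% X) x) (hY : MDiffAt (T% Y) x) (hY' : MDiffAt (T% Y') x)
    (hZ : MDiffAt (T% Z) x) :
    koszul I X (Y + Y') Z x = koszul I X Y Z x + koszul I X Y' Z x := by
  simp only [koszul, metric_add_left, metric_add_right,
    mvfderiv_add (mdiffAt_metric hY hZ) (mdiffAt_metric hY' hZ),
    mvfderiv_add (mdiffAt_metric hX hY) (mdiffAt_metric hX hY')]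
  simp only [metric_apply, mlieBracket_add_left hY hY', mlieBracket_add_right hY hY',
    Pi.add_apply, inner_add_left, map_add, add_apply]
  ring

lemma koszul_smul_mid {X Y Z : Π x : M, TangentSpace I x} {f : M → ℝ} {x : M}
    (hf : MDiffAt f x) (hX : MDiffAt (T% X) x) (hY : MDiffAt (T% Y) x) (hZ : MDiffAt (T% Z) x) :
    koszul I X (f • Y) Z x
      = f x * koszul I X Y Z x + mvfderiv I f x (X x) * inner ℝ (Y x) (Z x) := by
  simp only [koszul, metric_smul_left, metric_smul_right,
    mvfderiv_mul hf (mdiffAt_metric hY hZ), mvfderiv_mul hf (mdiffAt_metric hX hY)]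
  simp only [metric_apply, mlieBracket_smul_left hf hY, mlieBracket_smul_right hf hY,
    Pi.smul_apply', Pi.mul_apply, inner_add_left, real_inner_smul_left, map_smul, smul_eq_mul,
    add_apply, smul_apply, neg_smul, inner_neg_left]
  rw [real_inner_comm (Y x) (X x)]
  ring

variable (I) in
/-- The bilinear form `(v, w) ↦ g(∇_v Y, w)` on `T_xM` given by the Koszul formula, for a vector
field `Y` that is differentiable at `x`. -/
def koszulForm (Y : Π x : M, TangentSpace I x) (x : M) (hY : MDiffAt (T% Y) x) :
    TangentSpace I x →L[ℝ] TangentSpace I x →L[ℝ] ℝ :=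
  TensorialAt.mkHom₂ (I := I) (F := E) (F' := E) (fun X Z ↦ koszul I X Y Z x) x
    (fun _ hZ ↦ ⟨fun hf hX ↦ koszul_smul_left hf hX hY hZ,
      fun hX hX' ↦ koszul_add_left hX hX' hY hZ⟩)
    (fun _ hX ↦ ⟨fun hf hZ ↦ koszul_smul_right hf hX hY hZ,
      fun hZ hZ' ↦ koszul_add_right hX hY hZ hZ'⟩)

lemma koszulForm_apply {X Y Z : Π x : M, TangentSpace I x} {x : M}
    (hX : MDiffAt (T% X) x) (hY : MDiffAt (T% Y) x) (hZ : MDiffAt (T% Z) x) :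
    koszulForm I Y x hY (X x) (Z x) = koszul I X Y Z x :=
  TensorialAt.mkHom₂_apply _ _ hX hZ

variable (I) in
/-- The musical isomorphism `T*_xM → T_xM` of the metric: `g(sharp φ, w) = φ w`. -/
def sharp (x : M) : (TangentSpace I x →L[ℝ] ℝ) →L[ℝ] TangentSpace I x :=
  haveI : FiniteDimensional ℝ (TangentSpace I x) := inferInstanceAs (FiniteDimensional ℝ E)
  haveI : CompleteSpace (TangentSpace I x) := FiniteDimensional.complete ℝ (TangentSpace I x)
  { toFun := fun φ ↦ (InnerProductSpace.toDual ℝ (TangentSpace I x)).symm φ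
    map_add' := fun φ ψ ↦ map_add _ φ ψ
    map_smul' := fun c φ ↦ by simp
    cont := (InnerProductSpace.toDual ℝ (TangentSpace I x)).symm.continuous }

lemma inner_sharp (x : M) (φ : TangentSpace I x →L[ℝ] ℝ) (w : TangentSpace I x) :
    inner ℝ (sharp I x φ) w = φ w := by
  have : FiniteDimensional ℝ (TangentSpace I x) := inferInstanceAs (FiniteDimensional ℝ E)
  have : CompleteSpace (TangentSpace I x) := FiniteDimensional.complete ℝ (TangentSpace I x)
  exact InnerProductSpace.toDual_symm_apply (𝕜 := ℝ) (E := TangentSpace I x) (x := w) (y := φ)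

open scoped Classical in
variable (I) in
/-- The endomorphism `v ↦ ∇_v Y` of `T_xM`, as given by the Koszul formula
(and `0` if `Y` is not differentiable at `x`). -/
def leviCivitaFun (Y : Π x : M, TangentSpace I x) (x : M) :
    TangentSpace I x →L[ℝ] TangentSpace I x :=
  if hY : MDiffAt (T% Y) x then (sharp I x).comp (koszulForm I Y x hY) else 0

lemma inner_leviCivitaFun {X Y Z : Π x : M, TangentSpace I x} {x : M}
    (hX : MDiffAt (T% X) x) (hY : MDiffAt (T% Y) x) (hZ : MDiffAt (T% Z) x) :
    inner ℝ (leviCivitaFun I Y x (X x)) (Z x) = koszul I X Y Z x := by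
  rw [leviCivitaFun, dif_pos hY, ContinuousLinearMap.comp_apply, inner_sharp,
    koszulForm_apply hX hY hZ]


lemma clm_ext_of_koszul {x : M} {A B : TangentSpace I x →L[ℝ] TangentSpace I x}
    (h : ∀ X Z : Π x : M, TangentSpace I x, MDiffAt (T% X) x → MDiffAt (T% Z) x →
      inner ℝ (A (X x)) (Z x) = inner ℝ (B (X x)) (Z x)) : A = B := by
  ext v
  refine ext_inner_right ℝ fun w ↦ ?_
  simpa using h (FiberBundle.extend E v) (FiberBundle.extend E w)
    (FiberBundle.mdifferentiableAt_extend ..) (FiberBundle.mdifferentiableAt_extend ..)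

variable (I M) in
/-- The Levi-Civita connection of the Riemannian manifold `M`. The value `(∇_v Y)(x)` is written
`leviCivita I M Y x v`. -/
def leviCivita : CovariantDerivative I E (fun x : M ↦ TangentSpace I x) where
  toFun := leviCivitaFun I
  isCovariantDerivativeOnUniv :=
    { add := fun {Y Y' x} hY hY' _ ↦ clm_ext_of_koszul fun X Z hX hZ ↦ by
        rw [add_apply, inner_add_left, inner_leviCivitaFun hX hY hZ,
          inner_leviCivitaFun hX hY' hZ, inner_leviCivitaFun hX (mdifferentiableAt_add_section hY hY') hZ,
          koszul_add_mid hX hY hY' hZ]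
      leibniz := fun {Y f x} hY hf _ ↦ clm_ext_of_koszul fun X Z hX hZ ↦ by
        rw [add_apply, inner_add_left, smul_apply,
          real_inner_smul_left, inner_leviCivitaFun hX hY hZ,
          inner_leviCivitaFun hX (hf.smul_section hY) hZ,
          koszul_smul_mid hf hX hY hZ, ContinuousLinearMap.smulRight_apply, real_inner_smul_left] }

lemma inner_leviCivita {X Y Z : Π x : M, TangentSpace I x} {x : M}
    (hX : MDiffAt (T% X) x) (hY : MDiffAt (T% Y) x) (hZ : MDiffAt (T% Z) x) :
    inner ℝ (leviCivita I M Y x (X x)) (Z x) = koszul I X Y Z x :=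
  inner_leviCivitaFun hX hY hZ

/-- The Levi-Civita connection is torsion free. -/
theorem leviCivita_torsion : (leviCivita I M).torsion = 0 := by
  rw [CovariantDerivative.torsion_eq_zero_iff]
  intro X Y x hX hY
  refine ext_inner_right ℝ fun w ↦ ?_
  obtain ⟨Z, hZ, rfl⟩ : ∃ Z : Π x : M, TangentSpace I x, MDiffAt (T% Z) x ∧ Z x = w :=
    ⟨FiberBundle.extend E w, FiberBundle.mdifferentiableAt_extend .., by simp⟩
  rw [inner_sub_left, inner_leviCivita hX hY hZ, inner_leviCivita hY hX hZ, koszul, koszul,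
    metric_comm Y Z, metric_comm X Z, metric_comm Y X]
  simp only [metric_apply, mlieBracket_swap_apply (V := Y) (W := X),
    mlieBracket_swap_apply (V := Z) (W := X), mlieBracket_swap_apply (V := Z) (W := Y),
    inner_neg_left]
  ring

/-- `∇` is compatible with the metric: `X g(Y,Z) = g(∇_X Y, Z) + g(Y, ∇_X Z)`. -/
theorem leviCivita_metric {X Y Z : Π x : M, TangentSpace I x} {x : M}
    (hX : MDiffAt (T% X) x) (hY : MDiffAt (T% Y) x) (hZ : MDiffAt (T% Z) x) :
    mvfderiv I (metric I Y Z) x (X x) =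
      inner ℝ (leviCivita I M Y x (X x)) (Z x) + inner ℝ (Y x) (leviCivita I M Z x (X x)) := by
  rw [real_inner_comm (leviCivita I M Z x (X x)), inner_leviCivita hX hY hZ,
    inner_leviCivita hX hZ hY, koszul, koszul,
    metric_comm Z Y, metric_comm Y X, metric_comm Z X]
  simp only [metric_apply, mlieBracket_swap_apply (V := Y) (W := X),
    mlieBracket_swap_apply (V := Z) (W := X), mlieBracket_swap_apply (V := Z) (W := Y),
    inner_neg_left]
  ring

variable (I) in
/-- The gradient `∇u`: `g(∇u, w) = du(w)`. -/
def grad (u : M → ℝ) (x : M) : TangentSpace I x := sharp I x (mvfderiv I u x)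

variable (I) in
/-- The divergence `div Y = trace (v ↦ ∇_v Y)`. -/
def div (Y : Π x : M, TangentSpace I x) (x : M) : ℝ :=
  LinearMap.trace ℝ (TangentSpace I x) (leviCivita I M Y x : TangentSpace I x →ₗ[ℝ] TangentSpace I x)

variable (I) in
/-- The Laplace-Beltrami operator `Δu = div (∇u) = trace (v ↦ ∇_v ∇u)`, the trace of `Hess u`. -/
def laplacian (u : M → ℝ) : M → ℝ := div I (grad I u)

variable (I) in
/-- The weighted Laplacian `Δ_Ψ u = Δu - g(∇Ψ, ∇u)`. -/
def weightedLaplacian (Ψ u : M → ℝ) (x : M) : ℝ :=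
  laplacian I u x - metric I (grad I Ψ) (grad I u) x

variable (I) in
/-- `X` is a Killing vector field on the open set `Ω`: it is smooth there and
`(L_X g)(Y, Z) = g(∇_Y X, Z) + g(∇_Z X, Y) = 0` on `Ω`. The expression depends only on the values
`v`, `w` of `Y`, `Z` at the point. -/
def IsKillingOn (X : Π x : M, TangentSpace I x) (Ω : Set M) : Prop :=
  ContMDiffOn I I.tangent ∞ (fun x ↦ (⟨x, X x⟩ : TangentBundle I M)) Ω ∧
    ∀ x ∈ Ω, ∀ v w : TangentSpace I x,
      inner ℝ (leviCivita I M X x v) w + inner ℝ (leviCivita I M X x w) v = 0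

variable (I) in
/-- The derivative `X(u) = du(X)` of a function `u` along a vector field `X`. -/
def along (X : Π x : M, TangentSpace I x) (u : M → ℝ) (x : M) : ℝ := mvfderiv I u x (X x)

end WeightedManifold

end

open InnerProductSpace

noncomputable section

namespace WeightedManifold

variable {E : Type*} [NormedAddCommGroup E] [NormedSpace ℝ E]
  {H : Type*} [TopologicalSpace H] {I : ModelWithCorners ℝ E H}
  {M : Type*} [TopologicalSpace M] [ChartedSpace H M]
  [RiemannianBundle (fun x : M ↦ TangentSpace I x)]
  [FiniteDimensional ℝ E] [IsManifold I ∞ M]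
  [IsContMDiffRiemannianBundle I ∞ E (fun x : M ↦ TangentSpace I x)]

/-! ### Smoothness -/

/-! The flow of a Killing field preserves the metric, hence everything built from it. The proof is
the infinitesimal form of this remark, with no flow: torsion-freeness and metric compatibility turn
the Killing equation into X g(Y, Z) = g([X, Y], Z) + g(Y, [X, Z]) (`IsKillingOn.along_metric`), a
Leibniz rule for the action of X by Lie bracket. The Koszul expression is made of metrics,
derivatives and brackets, so it inherits the rule (`IsKillingOn.along_koszul`). Tracing over an
orthonormal frame gives X(div Y) = div [X, Y], and duality gives ∇(Xf) = [X, ∇f]; together, ΔX = XΔ.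
For the drift term, constancy of g(X, ∇Ψ) = XΨ gives [X, ∇Ψ] = ∇(XΨ) = 0, so that X g(∇Ψ, ∇f) =
g(∇Ψ, ∇(Xf)). Smoothness and the commutator identity for derivations are extracted from properties
of the Lie bracket and a smooth orthonormal frame, without coordinate computations. -/

lemma contMDiffAt_metric {X Y : Π x : M, TangentSpace I x} {x : M}
    (hX : CMDiffAt ∞ (T% X) x) (hY : CMDiffAt ∞ (T% Y) x) : CMDiffAt ∞ (metric I X Y) x :=
  ContMDiffAt.inner_bundle (E := fun x : M ↦ TangentSpace I x) hX hY

lemma contMDiffAt_mlieBracket {X Y : Π x : M, TangentSpace I x} {x : M}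
    (hX : CMDiffAt ∞ (T% X) x) (hY : CMDiffAt ∞ (T% Y) x) :
    CMDiffAt ∞ (T% (mlieBracket I X Y)) x := by
  have : IsManifold I (∞ + 1) M := inferInstanceAs (IsManifold I ∞ M)
  have : IsManifold I (minSmoothness ℝ 2) M := by
    simp only [minSmoothness_of_isRCLikeNormedField]
    infer_instance
  exact ContMDiffAt.mlieBracket_vectorField (m := ⊤) (n := ⊤) hX hY (by simp)

lemma jacobi_mlieBracket {X Y Z : Π x : M, TangentSpace I x} {x : M}
    (hX : CMDiffAt ∞ (T% X) x) (hY : CMDiffAt ∞ (T% Y) x) (hZ : CMDiffAt ∞ (T% Z) x) :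
    mlieBracket I X (mlieBracket I Y Z) x =
      mlieBracket I (mlieBracket I X Y) Z x + mlieBracket I Y (mlieBracket I X Z) x := by
  have : IsManifold I (minSmoothness ℝ 3) M := by
    simp only [minSmoothness_of_isRCLikeNormedField]
    infer_instance
  refine leibniz_identity_mlieBracket_apply (hX.of_le ?_) (hY.of_le ?_) (hZ.of_le ?_) <;>
  · simp only [minSmoothness_of_isRCLikeNormedField]
    exact WithTop.coe_le_coe.2 le_top

/-! ### Orthonormal frames -/

/-- Each Gram–Schmidt step subtracts projections onto earlier vectors; their coefficients are
quotients of metric functions, and linear independence at `x` keeps the denominators nonzero there.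
-/
lemma contMDiffAt_gramSchmidt {m : ℕ} {s : Fin m → Π x : M, TangentSpace I x} {x : M}
    (hs : ∀ i, CMDiffAt ∞ (T% (s i)) x)
    (hli : LinearIndependent ℝ fun i ↦ s i x) (i : Fin m) :
    CMDiffAt ∞ (T% (fun y ↦ gramSchmidt ℝ (fun j ↦ s j y) i)) x := by
  induction i using WellFoundedLT.induction with
  | ind i ih =>
    simp_rw [gramSchmidt_def ℝ _ i, Submodule.starProjection_singleton]
    refine ContMDiffAt.sub_section (hs i) (ContMDiffAt.sum_section fun j hj ↦ ?_)
    have hg := ih j (by simpa using hj)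
    refine ContMDiffAt.smul_section
      (f := fun y ↦ inner ℝ (gramSchmidt ℝ (fun k ↦ s k y) j) (s i y) /
        ((‖gramSchmidt ℝ (fun k ↦ s k y) j‖ ^ 2 : ℝ))) ?_ hg
    refine ContMDiffAt.div₀ (contMDiffAt_metric hg (hs i)) ?_ ?_
    · simp_rw [← real_inner_self_eq_norm_sq]
      exact contMDiffAt_metric hg hg
    · exact pow_ne_zero _ (norm_ne_zero_iff.2 (gramSchmidt_ne_zero _ hli))

lemma contMDiffAt_gramSchmidtNormed {m : ℕ} {s : Fin m → Π x : M, TangentSpace I x} {x : M}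
    (hs : ∀ i, CMDiffAt ∞ (T% (s i)) x)
    (hli : LinearIndependent ℝ fun i ↦ s i x) (i : Fin m) :
    CMDiffAt ∞ (T% (fun y ↦ gramSchmidtNormed ℝ (fun j ↦ s j y) i)) x := by
  have hg := contMDiffAt_gramSchmidt hs hli i
  have h0 : gramSchmidt ℝ (fun j ↦ s j x) i ≠ 0 := gramSchmidt_ne_zero _ hli
  refine ContMDiffAt.smul_section
    (f := fun y ↦ (‖gramSchmidt ℝ (fun k ↦ s k y) i‖ : ℝ)⁻¹) ?_ hg
  refine ContMDiffAt.inv₀ ?_ (norm_ne_zero_iff.2 h0)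
  -- The norm is the square root of a smooth function that is nonzero at `x`.
  have hn : (fun y ↦ ‖gramSchmidt ℝ (fun k ↦ s k y) i‖) = Real.sqrt ∘
      metric I (fun y ↦ gramSchmidt ℝ (fun k ↦ s k y) i)
        (fun y ↦ gramSchmidt ℝ (fun k ↦ s k y) i) := by
    ext y
    simp [metric, Real.sqrt_sq]
  rw [hn]
  refine ContMDiffAt.comp (I' := 𝓘(ℝ, ℝ)) x
    (Real.contDiffAt_sqrt ?_).contMDiffAt (contMDiffAt_metric hg hg)
  exact inner_self_ne_zero.2 h0

variable (I M) in
/-- Near every point there is a smooth orthonormal frame. -/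
lemma exists_orthonormalFrame (x : M) :
    ∃ (U : Set M) (e : Fin (Module.finrank ℝ E) → Π y : M, TangentSpace I y), IsOpen U ∧ x ∈ U ∧
      (∀ y ∈ U, ∀ i, CMDiffAt ∞ (T% (e i)) y) ∧ ∀ y ∈ U, Orthonormal ℝ fun i ↦ e i y := by
  let t := trivializationAt E (fun x : M ↦ TangentSpace I x) x
  have hf : IsLocalFrameOn I E ∞ (t.localFrame (Module.finBasis ℝ E)) t.baseSet :=
    t.isLocalFrameOn_localFrame_baseSet I ∞ (Module.finBasis ℝ E)
  refine ⟨t.baseSet,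
    fun i y ↦ gramSchmidtNormed ℝ (fun j ↦ t.localFrame (Module.finBasis ℝ E) j y) i,
    t.open_baseSet, FiberBundle.mem_baseSet_trivializationAt' x, fun y hy i ↦ ?_, fun y hy ↦ ?_⟩
  · exact contMDiffAt_gramSchmidtNormed (fun j ↦ hf.contMDiffAt t.open_baseSet hy j)
      (hf.linearIndependent hy) i
  · exact gramSchmidtNormed_orthonormal (hf.linearIndependent hy)

/-- An orthonormal family of `dim M` tangent vectors, as an orthonormal basis. -/
def orthonormalBasisOfFrame {x : M} {e : Fin (Module.finrank ℝ E) → TangentSpace I x}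
    (he : Orthonormal ℝ e) :
    OrthonormalBasis (Fin (Module.finrank ℝ E)) ℝ (TangentSpace I x) :=
  haveI : FiniteDimensional ℝ (TangentSpace I x) := inferInstanceAs (FiniteDimensional ℝ E)
  OrthonormalBasis.mk he (he.linearIndependent.span_eq_top_of_card_eq_finrank'
    (by rw [Fintype.card_fin]; rfl)).ge

@[simp]
lemma coe_orthonormalBasisOfFrame {x : M} {e : Fin (Module.finrank ℝ E) → TangentSpace I x}
    (he : Orthonormal ℝ e) : ⇑(orthonormalBasisOfFrame he) = e :=
  OrthonormalBasis.coe_mk ..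

lemma sum_inner_smul_frame {x : M} {e : Fin (Module.finrank ℝ E) → TangentSpace I x}
    (he : Orthonormal ℝ e) (v : TangentSpace I x) : ∑ i, inner ℝ (e i) v • e i = v := by
  simpa using (orthonormalBasisOfFrame he).sum_repr' v

/-! ### Derivatives of functions along vector fields -/

lemma along_congr {X : Π x : M, TangentSpace I x} {f g : M → ℝ} {x : M} (h : f =ᶠ[𝓝 x] g) :
    along I X f x = along I X g x := by
  simp only [along, mvfderiv, h.mfderiv_eq]
  rfl

/-- For a unit frame field e, the Leibniz rule [X, fe] = (Xf)e + f[X, e] recovers Xf as g([X, fe] -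
f[X, e], e), and brackets and metrics of smooth fields are smooth. The assumption on `f` is made
near `x`: being C^∞ at a point only gives, for each n, a neighbourhood of class C^n, possibly
shrinking with n. -/
lemma contMDiffAt_along {X : Π x : M, TangentSpace I x} {f : M → ℝ} {x : M}
    (hX : CMDiffAt ∞ (T% X) x) (hf : ∀ᶠ y in 𝓝 x, CMDiffAt ∞ f y) :
    CMDiffAt ∞ (along I X f) x := by
  obtain ⟨U, e, hU, hxU, he, ho⟩ := exists_orthonormalFrame I M x
  -- In dimension 0 there is no frame vector to test against, but all tangent vectors vanish.
  rcases Nat.eq_zero_or_pos (Module.finrank ℝ E) with h0 | h0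
  · have : Subsingleton E := Module.finrank_zero_iff.1 h0
    have h : along I X f = fun _ ↦ 0 := by
      ext y
      rw [along, show X y = 0 from Subsingleton.elim (α := E) _ _, map_zero]
    rw [h]
    exact contMDiffAt_const
  · let i : Fin (Module.finrank ℝ E) := ⟨0, h0⟩
    have hex := he x hxU i
    have key : along I X f =ᶠ[𝓝 x]
        metric I (mlieBracket I X (f • e i) - f • mlieBracket I X (e i)) (e i) := by
      filter_upwards [hf, hU.mem_nhds hxU] with y hfy hy
      have h1 : inner ℝ (e i y) (e i y) = (1 : ℝ) := by
        simp [(ho y hy).norm_eq_one i]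
      rw [metric_apply, Pi.sub_apply, Pi.smul_apply',
        mlieBracket_smul_right (hfy.mdifferentiableAt (by simp))
          ((he y hy i).mdifferentiableAt (by simp)), add_sub_cancel_right,
        real_inner_smul_left, h1, mul_one]
      rfl
    refine ContMDiffAt.congr_of_eventuallyEq (contMDiffAt_metric ?_ hex) key
    have hfx := hf.self_of_nhds
    exact (contMDiffAt_mlieBracket hX (hfx.smul_section hex)).sub_section
      (hfx.smul_section (contMDiffAt_mlieBracket hX hex))

/-- The Lie bracket of vector fields is the commutator of the derivations they define. -/
lemma along_mlieBracket {X Y : Π x : M, TangentSpace I x} {f : M → ℝ} {x : M}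
    (hX : CMDiffAt ∞ (T% X) x) (hY : CMDiffAt ∞ (T% Y) x) (hf : ∀ᶠ y in 𝓝 x, CMDiffAt ∞ f y) :
    along I (mlieBracket I X Y) f x = along I X (along I Y f) x - along I Y (along I X f) x := by
  obtain ⟨U, e, hU, hxU, he, ho⟩ := exists_orthonormalFrame I M x
  rcases Nat.eq_zero_or_pos (Module.finrank ℝ E) with h0 | h0
  · have : Subsingleton E := Module.finrank_zero_iff.1 h0
    have h (Z : Π x : M, TangentSpace I x) (g : M → ℝ) : along I Z g x = 0 := by
      rw [along, show Z x = 0 from Subsingleton.elim (α := E) _ _, map_zero]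
    simp only [h, sub_zero]
  · let i : Fin (Module.finrank ℝ E) := ⟨0, h0⟩
    have hfx := hf.self_of_nhds
    have hex := he x hxU i
    have hW : e i x ≠ 0 := (ho x hxU).ne_zero i
    have d {g : M → ℝ} (hg : CMDiffAt ∞ g x) : MDiffAt g x := hg.mdifferentiableAt (by simp)
    have D {Z : Π x : M, TangentSpace I x} (hZ : CMDiffAt ∞ (T% Z) x) : MDiffAt (T% Z) x :=
      hZ.mdifferentiableAt (by simp)
    have expand (Z : Π x : M, TangentSpace I x) : mlieBracket I Z (f • e i) =ᶠ[𝓝 x]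
        along I Z f • e i + f • mlieBracket I Z (e i) := by
      filter_upwards [hf, hU.mem_nhds hxU] with y hfy hy
      exact mlieBracket_smul_right (hfy.mdifferentiableAt (by simp))
          ((he y hy i).mdifferentiableAt (by simp))
    have second {Z Z' : Π x : M, TangentSpace I x} (hZ' : CMDiffAt ∞ (T% Z') x) :
        mlieBracket I Z (mlieBracket I Z' (f • e i)) x =
          (along I Z (along I Z' f) x • e i x + along I Z' f x • mlieBracket I Z (e i) x) +
          (along I Z f x • mlieBracket I Z' (e i) x
            + f x • mlieBracket I Z (mlieBracket I Z' (e i)) x) := by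
      have ha := contMDiffAt_along hZ' hf
      have hb := contMDiffAt_mlieBracket hZ' hex
      rw [Filter.EventuallyEq.mlieBracket_vectorField_eq (V₁ := Z) .rfl (expand Z'),
        mlieBracket_add_right (D (ha.smul_section hex)) (D (hfx.smul_section hb)),
        mlieBracket_smul_right (d ha) (D hex), mlieBracket_smul_right (d hfx) (D hb)]
      rfl
    -- Jacobi for X, Y, fe, expanded by the Leibniz rule: the cross terms (Xf)[Y, e] and (Yf)[X, e]
    -- cancel, Jacobi for X, Y, e removes the terms carrying f, and what remains is a multiple of e,
    -- which is nonzero at `x`.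
    have hj := jacobi_mlieBracket hX hY (hfx.smul_section hex)
    rw [second hY, second hX, (expand _).self_of_nhds, Pi.add_apply, Pi.smul_apply',
      Pi.smul_apply', jacobi_mlieBracket hX hY hex] at hj
    have h : (along I (mlieBracket I X Y) f x
        - (along I X (along I Y f) x - along I Y (along I X f) x)) • e i x = 0 := by
      rw [← sub_eq_zero] at hj
      rw [← neg_eq_zero, ← hj]
      module
    exact sub_eq_zero.1 ((smul_eq_zero.1 h).resolve_right hW)

lemma along_add {X : Π x : M, TangentSpace I x} {f g : M → ℝ} {x : M}
    (hf : MDiffAt f x) (hg : MDiffAt g x) :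
    along I X (f + g) x = along I X f x + along I X g x := by
  simp [along, mvfderiv_add hf hg]

lemma along_sub {X : Π x : M, TangentSpace I x} {f g : M → ℝ} {x : M}
    (hf : MDiffAt f x) (hg : MDiffAt g x) :
    along I X (f - g) x = along I X f x - along I X g x := by
  simp [along, mvfderiv_sub hf hg]

lemma along_const (X : Π x : M, TangentSpace I x) (c : ℝ) (x : M) :
    along I X (fun _ ↦ c) x = 0 := by
  simp [along, mvfderiv_const]

lemma along_const_mul {X : Π x : M, TangentSpace I x} (c : ℝ) {f : M → ℝ} {x : M}
    (hf : MDiffAt f x) : along I X ((fun _ ↦ c) * f) x = c * along I X f x := by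
  simp [along, mvfderiv_mul (mdifferentiableAt_const (c := c)) hf, mvfderiv_const]

lemma along_sum {ι : Type*} {X : Π x : M, TangentSpace I x} {f : ι → M → ℝ} {x : M}
    (s : Finset ι) (hf : ∀ i ∈ s, CMDiffAt ∞ (f i) x) :
    along I X (∑ i ∈ s, f i) x = ∑ i ∈ s, along I X (f i) x := by
  classical
  induction s using Finset.induction_on with
  | empty => exact along_const X 0 x
  | insert i s hi ih =>
    have hs : ∀ j ∈ s, CMDiffAt ∞ (f j) x := fun j hj ↦ hf j (Finset.mem_insert_of_mem hj)
    rw [Finset.sum_insert hi, Finset.sum_insert hi, ← ih hs, along_add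
      ((hf i (Finset.mem_insert_self i s)).mdifferentiableAt (by simp))
      ((contMDiffAt_finsetSum' hs).mdifferentiableAt (by simp))]

/-! ### The gradient -/

lemma inner_grad (f : M → ℝ) (x : M) (w : TangentSpace I x) :
    inner ℝ (grad I f x) w = mvfderiv I f x w :=
  inner_sharp x _ w

lemma metric_grad (f : M → ℝ) (X : Π x : M, TangentSpace I x) :
    metric I (grad I f) X = along I X f :=
  funext fun x ↦ inner_grad f x (X x)

lemma contMDiffAt_grad {f : M → ℝ} {x : M} (hf : ∀ᶠ y in 𝓝 x, CMDiffAt ∞ f y) :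
    CMDiffAt ∞ (T% (grad I f)) x := by
  obtain ⟨U, e, hU, hxU, he, ho⟩ := exists_orthonormalFrame I M x
  have h : CMDiffAt ∞ (T% (fun y ↦ ∑ i, (along I (e i) f • e i) y)) x :=
    ContMDiffAt.sum_section fun i _ ↦
      (contMDiffAt_along (he x hxU i) hf).smul_section (he x hxU i)
  refine h.congr_of_eventuallyEq ?_
  filter_upwards [hU.mem_nhds hxU] with y hy
  have hs := sum_inner_smul_frame (ho y hy) (grad I f y)
  rw [← hs]
  congr 1
  refine Finset.sum_congr rfl fun i _ ↦ ?_
  rw [real_inner_comm, inner_grad]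
  rfl

/-! ### The divergence in an orthonormal frame -/

/-- Replaces the connection by the Koszul expression, so that smoothness, locality and invariance of
the divergence can be checked on metrics and brackets alone. -/
lemma div_eq_sum_koszul {e : Fin (Module.finrank ℝ E) → Π x : M, TangentSpace I x} {x : M}
    (he : ∀ i, MDiffAt (T% (e i)) x) (ho : Orthonormal ℝ fun i ↦ e i x)
    {Y : Π x : M, TangentSpace I x} (hY : MDiffAt (T% Y) x) :
    div I Y x = ∑ i, koszul I (e i) Y (e i) x := by
  rw [div, LinearMap.trace_eq_sum_inner _ (orthonormalBasisOfFrame ho)]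
  refine Finset.sum_congr rfl fun i _ ↦ ?_
  rw [real_inner_comm, coe_orthonormalBasisOfFrame]
  exact inner_leviCivita (he i) hY (he i)

lemma koszul_congr_mid {X Y Y' Z : Π x : M, TangentSpace I x} {x : M} (h : Y =ᶠ[𝓝 x] Y') :
    koszul I X Y Z x = koszul I X Y' Z x := by
  have h1 : metric I Y Z =ᶠ[𝓝 x] metric I Y' Z := h.mono fun y hy ↦ by simp [metric, hy]
  have h2 : metric I X Y =ᶠ[𝓝 x] metric I X Y' := h.mono fun y hy ↦ by simp [metric, hy]
  have h3 : mlieBracket I X Y x = mlieBracket I X Y' x :=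
    Filter.EventuallyEq.mlieBracket_vectorField_eq (V₁ := X) .rfl h
  have h4 : mlieBracket I Y Z x = mlieBracket I Y' Z x :=
    Filter.EventuallyEq.mlieBracket_vectorField_eq (W₁ := Z) h .rfl
  have h5 := along_congr (X := X) h1
  have h6 := along_congr (X := Z) h2
  simp only [along] at h5 h6
  simp only [koszul, h5, h6, metric, h3, h4, h.self_of_nhds]

lemma div_congr {Y Y' : Π x : M, TangentSpace I x} {x : M} (h : Y =ᶠ[𝓝 x] Y')
    (hY : MDiffAt (T% Y) x) (hY' : MDiffAt (T% Y') x) : div I Y x = div I Y' x := by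
  obtain ⟨U, e, hU, hxU, he, ho⟩ := exists_orthonormalFrame I M x
  have he' (i) : MDiffAt (T% (e i)) x := (he x hxU i).mdifferentiableAt (by simp)
  rw [div_eq_sum_koszul he' (ho x hxU) hY, div_eq_sum_koszul he' (ho x hxU) hY']
  exact Finset.sum_congr rfl fun i _ ↦ koszul_congr_mid h

lemma contMDiffAt_koszul {A B C : Π x : M, TangentSpace I x} {x : M}
    (hA : ∀ᶠ y in 𝓝 x, CMDiffAt ∞ (T% A) y) (hB : ∀ᶠ y in 𝓝 x, CMDiffAt ∞ (T% B) y)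
    (hC : ∀ᶠ y in 𝓝 x, CMDiffAt ∞ (T% C) y) : CMDiffAt ∞ (koszul I A B C) x := by
  have g {Y Z : Π x : M, TangentSpace I x} (hY : ∀ᶠ y in 𝓝 x, CMDiffAt ∞ (T% Y) y)
      (hZ : ∀ᶠ y in 𝓝 x, CMDiffAt ∞ (T% Z) y) : ∀ᶠ y in 𝓝 x, CMDiffAt ∞ (metric I Y Z) y := by
    filter_upwards [hY, hZ] with y using contMDiffAt_metric
  have a := hA.self_of_nhds
  have b := hB.self_of_nhds
  have c := hC.self_of_nhds
  exact contMDiffAt_const.mul ((((((contMDiffAt_along a (g hB hC)).add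
    (contMDiffAt_along b (g hC hA))).sub (contMDiffAt_along c (g hA hB))).add
    (contMDiffAt_metric (contMDiffAt_mlieBracket a b) c)).sub
    (contMDiffAt_metric (contMDiffAt_mlieBracket b c) a)).add
    (contMDiffAt_metric (contMDiffAt_mlieBracket c a) b))

lemma contMDiffAt_div {Y : Π x : M, TangentSpace I x} {x : M}
    (hY : ∀ᶠ y in 𝓝 x, CMDiffAt ∞ (T% Y) y) : CMDiffAt ∞ (div I Y) x := by
  obtain ⟨U, e, hU, hxU, he, ho⟩ := exists_orthonormalFrame I M x
  have he' (i) : ∀ᶠ y in 𝓝 x, CMDiffAt ∞ (T% (e i)) y :=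
    Filter.eventually_of_mem (hU.mem_nhds hxU) fun y hy ↦ he y hy i
  refine (contMDiffAt_finsetSum (t := Finset.univ) fun i _ ↦
    contMDiffAt_koszul (he' i) hY (he' i)).congr_of_eventuallyEq ?_
  filter_upwards [hU.mem_nhds hxU, hY] with y hy hYy
  exact div_eq_sum_koszul (fun i ↦ (he y hy i).mdifferentiableAt (by simp)) (ho y hy)
    (hYy.mdifferentiableAt (by simp))

/-! ### Killing fields -/

lemma leviCivita_sub_leviCivita {Y Z : Π x : M, TangentSpace I x} {x : M}
    (hY : MDiffAt (T% Y) x) (hZ : MDiffAt (T% Z) x) :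
    leviCivita I M Z x (Y x) - leviCivita I M Y x (Z x) = mlieBracket I Y Z x :=
  (CovariantDerivative.torsion_eq_zero_iff (leviCivita I M)).1 leviCivita_torsion hY hZ

section Killing

variable {X : Π x : M, TangentSpace I x} {Ω : Set M}

lemma IsKillingOn.contMDiffAt (hX : IsKillingOn I X Ω) (hΩ : IsOpen Ω) {x : M} (hx : x ∈ Ω) :
    CMDiffAt ∞ (T% X) x :=
  hX.1.contMDiffAt (hΩ.mem_nhds hx)

/-- The flow of a Killing field preserves the metric: `X g(Y, Z) = g([X, Y], Z) + g(Y, [X, Z])`. -/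
lemma IsKillingOn.along_metric (hX : IsKillingOn I X Ω) (hΩ : IsOpen Ω) {x : M} (hx : x ∈ Ω)
    {Y Z : Π x : M, TangentSpace I x} (hY : MDiffAt (T% Y) x) (hZ : MDiffAt (T% Z) x) :
    along I X (metric I Y Z) x =
      metric I (mlieBracket I X Y) Z x + metric I Y (mlieBracket I X Z) x := by
  have hXx : MDiffAt (T% X) x := (hX.contMDiffAt hΩ hx).mdifferentiableAt (by simp)
  have hk := hX.2 x hx (Y x) (Z x)
  rw [real_inner_comm (Y x)] at hk
  -- Substituting ∇_X Y = [X, Y] + ∇_Y X, and likewise for Z, leaves g(∇_Y X, Z) + g(Y, ∇_Z X),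
  -- which is zero by the Killing equation.
  rw [along, leviCivita_metric hXx hY hZ, metric_apply, metric_apply, ← leviCivita_sub_leviCivita hXx hY,
    ← leviCivita_sub_leviCivita hXx hZ,
    inner_sub_left, inner_sub_right]
  linarith

/-- XA = [X, A] + AX as derivations, and X g(B, C) is then expanded by invariance of the metric near
`x`. This handles the derivative terms of the Koszul expression. -/
lemma IsKillingOn.along_along_metric (hX : IsKillingOn I X Ω) (hΩ : IsOpen Ω) {x : M} (hx : x ∈ Ω)
    {A B C : Π x : M, TangentSpace I x}
    (hA : ∀ᶠ y in 𝓝 x, CMDiffAt ∞ (T% A) y) (hB : ∀ᶠ y in 𝓝 x, CMDiffAt ∞ (T% B) y)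
    (hC : ∀ᶠ y in 𝓝 x, CMDiffAt ∞ (T% C) y) :
    along I X (along I A (metric I B C)) x =
      along I (mlieBracket I X A) (metric I B C) x
        + along I A (metric I (mlieBracket I X B) C) x
        + along I A (metric I B (mlieBracket I X C)) x := by
  have hXx := hX.contMDiffAt hΩ hx
  have hBC : ∀ᶠ y in 𝓝 x, CMDiffAt ∞ (metric I B C) y := by
    filter_upwards [hB, hC] with y using contMDiffAt_metric
  have b := hB.self_of_nhds
  have c := hC.self_of_nhds
  have key : along I X (metric I B C) =ᶠ[𝓝 x]
      metric I (mlieBracket I X B) C + metric I B (mlieBracket I X C) := by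
    filter_upwards [hB, hC, hΩ.mem_nhds hx] with y hb hc hy
    exact hX.along_metric hΩ hy (hb.mdifferentiableAt (by simp)) (hc.mdifferentiableAt (by simp))
  rw [along_mlieBracket hXx hA.self_of_nhds hBC, along_congr key, along_add
    ((contMDiffAt_metric (contMDiffAt_mlieBracket hXx b) c).mdifferentiableAt (by simp))
    ((contMDiffAt_metric b (contMDiffAt_mlieBracket hXx c)).mdifferentiableAt (by simp))]
  ring

/-- Invariance of the metric, combined with the Jacobi identity for [X, [A, B]]. This handles the
bracket terms of the Koszul expression. -/
lemma IsKillingOn.along_metric_mlieBracket (hX : IsKillingOn I X Ω) (hΩ : IsOpen Ω) {x : M}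
    (hx : x ∈ Ω) {A B C : Π x : M, TangentSpace I x}
    (hA : CMDiffAt ∞ (T% A) x) (hB : CMDiffAt ∞ (T% B) x) (hC : CMDiffAt ∞ (T% C) x) :
    along I X (metric I (mlieBracket I A B) C) x =
      metric I (mlieBracket I (mlieBracket I X A) B) C x
        + metric I (mlieBracket I A (mlieBracket I X B)) C x
        + metric I (mlieBracket I A B) (mlieBracket I X C) x := by
  rw [hX.along_metric hΩ hx ((contMDiffAt_mlieBracket hA hB).mdifferentiableAt (by simp))
    (hC.mdifferentiableAt (by simp))]
  simp only [metric_apply, jacobi_mlieBracket (hX.contMDiffAt hΩ hx) hA hB, inner_add_left]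

/-- The flow of a Killing field preserves the Koszul expression. -/
lemma IsKillingOn.along_koszul (hX : IsKillingOn I X Ω) (hΩ : IsOpen Ω) {x : M} (hx : x ∈ Ω)
    {A B C : Π x : M, TangentSpace I x}
    (hA : ∀ᶠ y in 𝓝 x, CMDiffAt ∞ (T% A) y) (hB : ∀ᶠ y in 𝓝 x, CMDiffAt ∞ (T% B) y)
    (hC : ∀ᶠ y in 𝓝 x, CMDiffAt ∞ (T% C) y) :
    along I X (koszul I A B C) x =
      koszul I (mlieBracket I X A) B C x + koszul I A (mlieBracket I X B) C x
        + koszul I A B (mlieBracket I X C) x := by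
  have g {Y Z : Π x : M, TangentSpace I x} (hY : ∀ᶠ y in 𝓝 x, CMDiffAt ∞ (T% Y) y)
      (hZ : ∀ᶠ y in 𝓝 x, CMDiffAt ∞ (T% Z) y) : ∀ᶠ y in 𝓝 x, CMDiffAt ∞ (metric I Y Z) y := by
    filter_upwards [hY, hZ] with y using contMDiffAt_metric
  have d {f : M → ℝ} (hf : CMDiffAt ∞ f x) : MDiffAt f x := hf.mdifferentiableAt (by simp)
  have a := hA.self_of_nhds
  have b := hB.self_of_nhds
  have c := hC.self_of_nhds
  have k1 := contMDiffAt_along a (g hB hC)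
  have k2 := contMDiffAt_along b (g hC hA)
  have k3 := contMDiffAt_along c (g hA hB)
  have k4 := contMDiffAt_metric (contMDiffAt_mlieBracket a b) c
  have k5 := contMDiffAt_metric (contMDiffAt_mlieBracket b c) a
  have k6 := contMDiffAt_metric (contMDiffAt_mlieBracket c a) b
  have hk : koszul I A B C = (fun _ ↦ (1 / 2 : ℝ)) * (along I A (metric I B C)
      + along I B (metric I C A) - along I C (metric I A B) + metric I (mlieBracket I A B) C
      - metric I (mlieBracket I B C) A + metric I (mlieBracket I C A) B) := rfl
  have d2 := (d k1).add (d k2)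
  have d3 := d2.sub (d k3)
  have d4 := d3.add (d k4)
  have d5 := d4.sub (d k5)
  rw [hk, along_const_mul _ (d5.add (d k6)), along_add d5 (d k6), along_sub d4 (d k5),
    along_add d3 (d k4), along_sub d2 (d k3), along_add (d k1) (d k2),
    hX.along_along_metric hΩ hx hA hB hC, hX.along_along_metric hΩ hx hB hC hA,
    hX.along_along_metric hΩ hx hC hA hB, hX.along_metric_mlieBracket hΩ hx a b c,
    hX.along_metric_mlieBracket hΩ hx b c a, hX.along_metric_mlieBracket hΩ hx c a b]
  -- Each of the six Koszul terms has produced three; the eighteen regroup according to which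
  -- argument is bracketed with X.
  simp only [koszul, along]
  ring

/-- `X (div Y) = div [X, Y]` for a Killing field `X`. -/
lemma IsKillingOn.along_div (hX : IsKillingOn I X Ω) (hΩ : IsOpen Ω) {x : M} (hx : x ∈ Ω)
    {Y : Π x : M, TangentSpace I x} (hY : ∀ᶠ y in 𝓝 x, CMDiffAt ∞ (T% Y) y) :
    along I X (div I Y) x = div I (mlieBracket I X Y) x := by
  obtain ⟨U, e, hU, hxU, he, ho⟩ := exists_orthonormalFrame I M x
  have hXx := hX.contMDiffAt hΩ hx
  have hYx := hY.self_of_nhds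
  have D {Z : Π x : M, TangentSpace I x} {y : M} (hZ : CMDiffAt ∞ (T% Z) y) : MDiffAt (T% Z) y :=
    hZ.mdifferentiableAt (by simp)
  have he' (i) : ∀ᶠ y in 𝓝 x, CMDiffAt ∞ (T% (e i)) y :=
    Filter.eventually_of_mem (hU.mem_nhds hxU) fun y hy ↦ he y hy i
  have hdiv : div I Y =ᶠ[𝓝 x] ∑ i, koszul I (e i) Y (e i) := by
    filter_upwards [hU.mem_nhds hxU, hY] with y hy hYy
    rw [div_eq_sum_koszul (fun i ↦ D (he y hy i)) (ho y hy) (D hYy), Finset.sum_apply]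
  have hb (i) : CMDiffAt ∞ (T% (mlieBracket I X (e i))) x := contMDiffAt_mlieBracket hXx (he x hxU i)
  set B := koszulForm I Y x (D hYx) with hB
  -- Since g(e_i, e_j) is locally constant, invariance of the metric makes the matrix of [X, ·] on
  -- the frame skew-symmetric.
  have hskew (i j) : inner ℝ (e j x) (mlieBracket I X (e i) x)
      + inner ℝ (e i x) (mlieBracket I X (e j) x) = 0 := by
    have h := hX.along_metric hΩ hx (D (he x hxU i)) (D (he x hxU j))
    have hc : metric I (e i) (e j) =ᶠ[𝓝 x] fun _ ↦ if i = j then 1 else 0 := by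
      filter_upwards [hU.mem_nhds hxU] with y hy
      exact orthonormal_iff_ite.1 (ho y hy) i j
    rw [along_congr hc, along_const, metric_apply, metric_apply, real_inner_comm] at h
    exact h.symm
  have h1 (i) : koszul I (mlieBracket I X (e i)) Y (e i) x
      = ∑ j, inner ℝ (e j x) (mlieBracket I X (e i) x) * B (e j x) (e i x) := by
    rw [← koszulForm_apply (D (hb i)) (D hYx) (D (he x hxU i)), ← hB]
    conv_lhs => rw [← sum_inner_smul_frame (ho x hxU) (mlieBracket I X (e i) x)]
    simp [map_sum]
  have h2 (i) : koszul I (e i) Y (mlieBracket I X (e i)) x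
      = ∑ j, inner ℝ (e j x) (mlieBracket I X (e i) x) * B (e i x) (e j x) := by
    rw [← koszulForm_apply (D (he x hxU i)) (D hYx) (D (hb i)), ← hB]
    conv_lhs => rw [← sum_inner_smul_frame (ho x hxU) (mlieBracket I X (e i) x)]
    simp [map_sum]
  -- The error terms from the frame not being X-invariant: after swapping indices in the first
  -- double sum, each B(e_i, e_j) has a coefficient that vanishes by skewness. No symmetry of B is
  -- needed.
  have hzero : ∑ i, koszul I (mlieBracket I X (e i)) Y (e i) x
      + ∑ i, koszul I (e i) Y (mlieBracket I X (e i)) x = 0 := by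
    simp only [h1, h2]
    rw [Finset.sum_comm (γ := Fin (Module.finrank ℝ E)), ← Finset.sum_add_distrib]
    refine Finset.sum_eq_zero fun i _ ↦ ?_
    rw [← Finset.sum_add_distrib]
    refine Finset.sum_eq_zero fun j _ ↦ ?_
    rw [← add_mul, hskew, zero_mul]
  rw [along_congr hdiv, along_sum _ fun i _ ↦ contMDiffAt_koszul (he' i) hY (he' i),
    div_eq_sum_koszul (fun i ↦ D (he x hxU i)) (ho x hxU) (D (contMDiffAt_mlieBracket hXx hYx))]
  simp only [hX.along_koszul hΩ hx (he' _) hY (he' _), Finset.sum_add_distrib]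
  linarith

/-- The gradient of `X(f)` is `[X, ∇f]` for a Killing field `X`. -/
lemma IsKillingOn.grad_along (hX : IsKillingOn I X Ω) (hΩ : IsOpen Ω) {x : M} (hx : x ∈ Ω)
    {f : M → ℝ} (hf : ∀ᶠ y in 𝓝 x, CMDiffAt ∞ f y) :
    grad I (along I X f) x = mlieBracket I X (grad I f) x := by
  obtain ⟨U, e, hU, hxU, he, ho⟩ := exists_orthonormalFrame I M x
  refine InnerProductSpace.ext_inner_right_basis (𝕜 := ℝ)
    (orthonormalBasisOfFrame (ho x hxU)).toBasis fun i ↦ ?_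
  -- X(e_i f) = g([X, ∇f], e_i) + [X, e_i]f, and the commutator identity turns this into g([X, ∇f],
  -- e_i) = e_i(Xf).
  have hk := hX.along_metric hΩ hx ((contMDiffAt_grad hf).mdifferentiableAt (by simp))
    ((he x hxU i).mdifferentiableAt (by simp))
  rw [metric_grad, metric_grad, along_mlieBracket (hX.contMDiffAt hΩ hx) (he x hxU i) hf] at hk
  rw [OrthonormalBasis.coe_toBasis, coe_orthonormalBasisOfFrame, inner_grad]
  change along I (e i) (along I X f) x = metric I (mlieBracket I X (grad I f)) (e i) x
  linarith

/-- A Killing field `X` commutes with the Laplacian. -/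
lemma IsKillingOn.laplacian_along (hX : IsKillingOn I X Ω) (hΩ : IsOpen Ω) {x : M} (hx : x ∈ Ω)
    {f : M → ℝ} (hf : ∀ᶠ y in 𝓝 x, CMDiffAt ∞ f y) :
    laplacian I (along I X f) x = along I X (laplacian I f) x := by
  have hXx := hX.contMDiffAt hΩ hx
  have hgrad : ∀ᶠ y in 𝓝 x, CMDiffAt ∞ (T% (grad I f)) y :=
    hf.eventually_nhds.mono fun y ↦ contMDiffAt_grad
  have hXf : ∀ᶠ y in 𝓝 x, CMDiffAt ∞ (along I X f) y := by
    filter_upwards [hf.eventually_nhds, hΩ.mem_nhds hx] with y hfy hy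
    exact contMDiffAt_along (hX.contMDiffAt hΩ hy) hfy
  have heq : grad I (along I X f) =ᶠ[𝓝 x] mlieBracket I X (grad I f) := by
    filter_upwards [hf.eventually_nhds, hΩ.mem_nhds hx] with y hfy hy
    exact hX.grad_along hΩ hy hfy
  rw [laplacian, laplacian, hX.along_div hΩ hx hgrad]
  exact div_congr heq ((contMDiffAt_grad hXf).mdifferentiableAt (by simp))
    ((contMDiffAt_mlieBracket hXx hgrad.self_of_nhds).mdifferentiableAt (by simp))

/-- A Killing field `X` commutes with the weighted Laplacian if `g(X, ∇Ψ)` is constant. -/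
lemma IsKillingOn.weightedLaplacian_along (hX : IsKillingOn I X Ω) (hΩ : IsOpen Ω) {x : M}
    (hx : x ∈ Ω) {Ψ f : M → ℝ} (hΨ : ∀ᶠ y in 𝓝 x, CMDiffAt ∞ Ψ y)
    (hf : ∀ᶠ y in 𝓝 x, CMDiffAt ∞ f y) {c : ℝ} (hc : ∀ y ∈ Ω, metric I X (grad I Ψ) y = c) :
    weightedLaplacian I Ψ (along I X f) x = along I X (weightedLaplacian I Ψ f) x := by
  have hgrad : ∀ᶠ y in 𝓝 x, CMDiffAt ∞ (T% (grad I f)) y :=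
    hf.eventually_nhds.mono fun y ↦ contMDiffAt_grad
  have hgΨ := contMDiffAt_grad hΨ
  have hgf := contMDiffAt_grad hf
  have hΨ0 : mlieBracket I X (grad I Ψ) x = 0 := by
    have hconst : along I X Ψ =ᶠ[𝓝 x] fun _ ↦ c := by
      filter_upwards [hΩ.mem_nhds hx] with y hy
      rw [← metric_grad, metric_comm, hc y hy]
    rw [← hX.grad_along hΩ hx hΨ]
    refine ext_inner_right ℝ fun w ↦ ?_
    have h := (along_congr (X := FiberBundle.extend E w) hconst).trans (along_const _ _ _)
    rwa [along, FiberBundle.extend_apply_self, ← inner_grad, ← inner_zero_left w] at h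
  have hw : weightedLaplacian I Ψ f = laplacian I f - metric I (grad I Ψ) (grad I f) := rfl
  have hL : CMDiffAt ∞ (laplacian I f) x := contMDiffAt_div hgrad
  rw [hw, along_sub (hL.mdifferentiableAt (by simp))
    ((contMDiffAt_metric hgΨ hgf).mdifferentiableAt (by simp)), ← hX.laplacian_along hΩ hx hf,
    hX.along_metric hΩ hx (hgΨ.mdifferentiableAt (by simp)) (hgf.mdifferentiableAt (by simp)),
    weightedLaplacian, metric_apply, metric_apply, metric_apply, hΨ0, inner_zero_left, zero_add,
    hX.grad_along hΩ hx hf]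

end Killing

end WeightedManifold

end

theorem mainTheorem12
    {E : Type*} [NormedAddCommGroup E] [NormedSpace ℝ E] [FiniteDimensional ℝ E]
    {M : Type*} [TopologicalSpace M] [T2Space M] [SecondCountableTopology M]
    [ChartedSpace E M] [IsManifold 𝓘(ℝ, E) ∞ M]
    [RiemannianBundle (fun x : M ↦ TangentSpace 𝓘(ℝ, E) x)]
    [IsContMDiffRiemannianBundle 𝓘(ℝ, E) ∞ E (fun x : M ↦ TangentSpace 𝓘(ℝ, E) x)]
    (Ψ : M → ℝ) (hΨ : ContMDiff 𝓘(ℝ, E) 𝓘(ℝ, ℝ) ∞ Ψ)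
    (Ω : Set M) (hΩ : IsOpen Ω)
    (X : Π x : M, TangentSpace 𝓘(ℝ, E) x)
    (hX : WeightedManifold.IsKillingOn 𝓘(ℝ, E) X Ω)
    (hXΨ : ∃ c : ℝ, ∀ x ∈ Ω,
      WeightedManifold.metric 𝓘(ℝ, E) X (WeightedManifold.grad 𝓘(ℝ, E) Ψ) x = c)
    (u : M → ℝ) (hu : ContMDiffOn 𝓘(ℝ, E) 𝓘(ℝ, ℝ) ∞ u Ω) :
    ∀ x ∈ Ω,
      WeightedManifold.weightedLaplacian 𝓘(ℝ, E) Ψ (WeightedManifold.along 𝓘(ℝ, E) X u) x =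
        WeightedManifold.along 𝓘(ℝ, E) X (WeightedManifold.weightedLaplacian 𝓘(ℝ, E) Ψ u) x := by
  -- Only the germ of `u` at `x` matters, so smoothness on the open set Ω suffices although `u` is
  -- defined on all of M.
  obtain ⟨c, hc⟩ := hXΨ
  intro x hx
  exact hX.weightedLaplacian_along hΩ hx (Filter.Eventually.of_forall fun y ↦ hΨ.contMDiffAt)
    (Filter.eventually_of_mem (hΩ.mem_nhds hx) fun y hy ↦ hu.contMDiffAt (hΩ.mem_nhds hy)) hc
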